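/- Let $(N,h)$ be a connected (smooth, $n$-dimensional, oriented) Riemannian spin manifold with a fixed spin structure, and let $\Sigma N = P_{\mathrm{Spin}}(N)\times_{\mathrm{Spin}(n)}\Sigma_n$ be its complex spinor bundle, where $\Sigma_n$ is an irreducible complex representation of the Clifford algebra of $\mathbb{R}^n$ (with $v\cdot v=-|v|^2$). It carries the Clifford multiplication $V\cdot\phi$ by tangent vectors, the Hermitian product $\langle\cdot,\cdot\rangle$ (complex linear in the first entry, antilinear in the second, with tangent vectors acting skew-adjointly), the norm $|\phi|=\langle\phi,\phi\rangle^{1/2}$, and the connection $\nabla$ induced by the Levi-Civita connection of $h$. Let $W\in\Gamma(\mathrm{End}(TN))$ be a smooth field of $h$-symmetric endomorphisms with $W\not\equiv 0$, and let $\phi\in\Gamma(\Sigma N)$ be a smooth spinor field which is a generalized imaginary Killing spinor for $W$, i.e. $$\nabla_X\phi=\tfrac{i}{2}\,W(X)\cdot\phi\qquad\text{for all } X\in TN .$$ Let $U_\phi$ be the Dirac current of $\phi$, i.e. the vector field determined by $h(U_\phi,X)=-i\langle X\cdot\phi,\phi\rangle$ for all $X\in TN$, and write $|U_\phi|=\sqrt{h(U_\phi,U_\phi)}$.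 The spinor $\phi$ is said to be of type I if the function $q_\phi:=|\phi|^4-|U_\phi|^2$ vanishes identically. Then the following four conditions are equivalent: (a) $\phi$ is of type I; (b) $|U_\phi|=|\phi|^2$ on $N$; (c) for every $p\in N$ there is a $V\in T_pN$ with $i\,\phi(p)=V\cdot\phi(p)$; (d) $U_\phi\cdot\phi=i\,|U_\phi|\,\phi$ on $N$. -/

import Mathlib

open Bundle
open scoped Manifold ContDiff

noncomputable section

/-! ### Clifford algebra and complex spinor representation -/

/-- The quadratic form `v ↦ -|v|²` on `ℝⁿ`; its Clifford algebra is the real Clifford algebra of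
`ℝⁿ` with the sign convention `v · v = -|v|²`. -/
def cliffordForm (n : ℕ) : QuadraticForm ℝ (EuclideanSpace ℝ (Fin n)) :=
  -(LinearMap.BilinMap.toQuadraticMap (innerₗ (EuclideanSpace ℝ (Fin n))))

theorem cliffordForm_apply (n : ℕ) (v : EuclideanSpace ℝ (Fin n)) :
    cliffordForm n v = -‖v‖ ^ 2 := by
  simp [cliffordForm]

/-- The real Clifford algebra of Euclidean `ℝⁿ`. -/
abbrev Cl (n : ℕ) : Type := CliffordAlgebra (cliffordForm n)

/-- The inclusion of vectors `ℝⁿ → Cl n`. -/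
abbrev Cl.vec {n : ℕ} : EuclideanSpace ℝ (Fin n) →ₗ[ℝ] Cl n := CliffordAlgebra.ι (cliffordForm n)

/-- The spin group `Spin(n)`, inside the Clifford algebra. -/
abbrev Spin (n : ℕ) : Type := spinGroup (cliffordForm n)

/-- `S` as a complex spinor module `Σₙ`: an irreducible complex representation of the (complexified)
Clifford algebra of `ℝⁿ` on a Hermitian vector space on which vectors of `ℝⁿ` act as
skew-Hermitian operators. It is unique up to isometry for `n` even, and there are two of them
for `n` odd. (A representation of `Cl n ⊗ ℂ` on a complex vector space is the same as a
homomorphism of real algebras from `Cl n` to the complex-linear endomorphisms.) -/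
structure SpinorModule (n : ℕ) (S : Type*) [NormedAddCommGroup S] [InnerProductSpace ℂ S] where
  /-- The representation of the Clifford algebra. -/
  rep : Cl n →ₐ[ℝ] (S →L[ℂ] S)
  skew : ∀ (v : EuclideanSpace ℝ (Fin n)) (φ ψ : S),
    inner ℂ (rep (Cl.vec v) φ) ψ = -inner ℂ φ (rep (Cl.vec v) ψ)
  nontrivial : Nontrivial S
  irreducible : ∀ K : Submodule ℂ S,
    (∀ (v : EuclideanSpace ℝ (Fin n)), ∀ φ ∈ K, rep (Cl.vec v) φ ∈ K) → K = ⊥ ∨ K = ⊤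

section Manifold

variable {n : ℕ} {N : Type*} [TopologicalSpace N]
  [ChartedSpace (EuclideanSpace ℝ (Fin n)) N] [IsManifold (𝓡 n) ∞ N]
  [RiemannianBundle (fun x : N ↦ TangentSpace (𝓡 n) x)]

/-! ### The Levi-Civita connection -/

/-- The number `h(∇_X Y, Z)(x)`, where `∇` is the Levi-Civita connection of the Riemannian metric
`h`, as given by the Koszul formula. -/
def koszul (X Y Z : Π x : N, TangentSpace (𝓡 n) x) (x : N) : ℝ :=
  (1 / 2) *
    (mvfderiv (𝓡 n) (fun y ↦ inner ℝ (Y y) (Z y)) x (X x)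
      + mvfderiv (𝓡 n) (fun y ↦ inner ℝ (X y) (Z y)) x (Y x)
      - mvfderiv (𝓡 n) (fun y ↦ inner ℝ (X y) (Y y)) x (Z x)
      + inner ℝ (VectorField.mlieBracket (𝓡 n) X Y x) (Z x)
      - inner ℝ (VectorField.mlieBracket (𝓡 n) X Z x) (Y x)
      - inner ℝ (VectorField.mlieBracket (𝓡 n) Y Z x) (X x))

/-- Any metric and torsion-free connection on the tangent bundle is given by `koszul`. -/
theorem inner_covariantDerivative_eq_koszul
    [IsContMDiffRiemannianBundle (𝓡 n) 1 (EuclideanSpace ℝ (Fin n))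
      (fun x : N ↦ TangentSpace (𝓡 n) x)]
    (nabla : CovariantDerivative (𝓡 n) (EuclideanSpace ℝ (Fin n))
      (fun x : N ↦ TangentSpace (𝓡 n) x))
    (hmetric : nabla.IsMetricCompatible) (htorsion : nabla.torsion = 0)
    {X Y Z : Π x : N, TangentSpace (𝓡 n) x} {x : N}
    (hX : MDifferentiableAt (𝓡 n) ((𝓡 n).prod 𝓘(ℝ, EuclideanSpace ℝ (Fin n)))
      (fun y ↦ TotalSpace.mk' (EuclideanSpace ℝ (Fin n)) (E := fun x : N ↦ TangentSpace (𝓡 n) x)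
        y (X y)) x)
    (hY : MDifferentiableAt (𝓡 n) ((𝓡 n).prod 𝓘(ℝ, EuclideanSpace ℝ (Fin n)))
      (fun y ↦ TotalSpace.mk' (EuclideanSpace ℝ (Fin n)) (E := fun x : N ↦ TangentSpace (𝓡 n) x)
        y (Y y)) x)
    (hZ : MDifferentiableAt (𝓡 n) ((𝓡 n).prod 𝓘(ℝ, EuclideanSpace ℝ (Fin n)))
      (fun y ↦ TotalSpace.mk' (EuclideanSpace ℝ (Fin n)) (E := fun x : N ↦ TangentSpace (𝓡 n) x)
        y (Z y)) x) :
    inner ℝ (nabla Y x (X x)) (Z x) = koszul X Y Z x := by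
  have m1 := hmetric.mvfderiv_inner_eq X hY hZ
  have m2 := hmetric.mvfderiv_inner_eq Y hX hZ
  have m3 := hmetric.mvfderiv_inner_eq Z hX hY
  have t1 := nabla.torsion_eq_zero_iff.1 htorsion hX hY
  have t2 := nabla.torsion_eq_zero_iff.1 htorsion hX hZ
  have t3 := nabla.torsion_eq_zero_iff.1 htorsion hY hZ
  unfold koszul
  rw [m1, m2, m3, ← t1, ← t2, ← t3]
  simp only [inner_sub_left]
  rw [real_inner_comm (nabla Z x (X x)) (Y x), real_inner_comm (nabla Z x (Y x)) (X x),
    real_inner_comm (nabla Y x (Z x)) (X x)]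
  ring

/-! ### Spin structures -/

variable (n N) in
/-- A spin structure on the Riemannian manifold `N` (together with the orientation it induces),
given by a trivializing open cover of the principal bundle `P_Spin` and its transition functions:
over each set `U j` of the cover there is a smooth orthonormal frame of `TN` (the image in the frame
bundle of a local section `s_j` of `P_Spin`), and on each overlap a smooth `Spin(n)`-valued function
`trans i j` (with `s_j = s_i · trans i j`), lifting the transition function of the frames along the
double covering `Spin(n) → SO(n)`, `g ↦ (v ↦ g v g⁻¹)`, such that the cocycle condition holds. -/
structure SpinStructure (J : Type*) where
  /-- The open cover. -/
  U : J → Set N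
  isOpen_U : ∀ j, IsOpen (U j)
  cover : ∀ x, ∃ j, x ∈ U j
  /-- The local frames; they are used on `U j` only. -/
  frame : J → Fin n → Π x : N, TangentSpace (𝓡 n) x
  frame_smooth : ∀ j k, ContMDiffOn (𝓡 n) ((𝓡 n).prod 𝓘(ℝ, EuclideanSpace ℝ (Fin n))) ∞
    (fun x ↦ TotalSpace.mk' (EuclideanSpace ℝ (Fin n)) (E := fun x : N ↦ TangentSpace (𝓡 n) x)
      x (frame j k x)) (U j)
  frame_orthonormal : ∀ j, ∀ x ∈ U j, Orthonormal ℝ (fun k ↦ frame j k x)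
  /-- The transition functions; they are used on `U i ∩ U j` only. -/
  trans : J → J → N → Spin n
  /-- Smoothness of the transition functions, tested in linear coordinates on `Cl n`. -/
  trans_smooth : ∀ i j, ∀ l : Cl n →ₗ[ℝ] ℝ,
    ContMDiffOn (𝓡 n) 𝓘(ℝ, ℝ) ∞ (fun x ↦ l (trans i j x : Cl n)) (U i ∩ U j)
  trans_cocycle : ∀ i j k, ∀ x ∈ U i ∩ U j ∩ U k, trans i j x * trans j k x = trans i k x
  /-- Here the argument of `Cl.vec` on the left (right) is the coordinate vector of `V` with respect
  to the frame `i` (the frame `j`). -/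
  trans_frame : ∀ i j, ∀ x ∈ U i ∩ U j, ∀ V : TangentSpace (𝓡 n) x,
    Cl.vec (WithLp.toLp 2 fun k ↦ inner ℝ (frame i k x) V) =
      (trans i j x : Cl n) * Cl.vec (WithLp.toLp 2 fun k ↦ inner ℝ (frame j k x) V)
        * star (trans i j x : Cl n)

namespace SpinStructure

variable {J : Type*} (P : SpinStructure n N J)

/-- A chosen element of the cover containing the point `x`. -/
def indexAt (x : N) : J := Classical.choose (P.cover x)

theorem mem_indexAt (x : N) : x ∈ P.U (P.indexAt x) := Classical.choose_spec (P.cover x)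

theorem trans_self (j : J) (x : N) (hx : x ∈ P.U j) : P.trans j j x = 1 := by
  have h := P.trans_cocycle j j j x ⟨⟨hx, hx⟩, hx⟩
  simpa using h

variable {S : Type*} [NormedAddCommGroup S] [InnerProductSpace ℂ S] [FiniteDimensional ℂ S]
  (Δ : SpinorModule n S)

/-- The spinor bundle `ΣN = P_Spin ×_{Spin(n)} Σₙ`: the complex vector bundle with
fibre `Σₙ` glued by the transition functions `ρ(trans i j)` of the spin structure. -/
def spinorCore : VectorBundleCore ℂ N S J where
  baseSet := P.U
  isOpen_baseSet := P.isOpen_U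
  indexAt := P.indexAt
  mem_baseSet_at := P.mem_indexAt
  coordChange i j x := Δ.rep (P.trans j i x : Cl n)
  coordChange_self i x hx v := by simp [P.trans_self i x hx]
  continuousOn_coordChange i j := by
    rw [continuousOn_clm_apply]
    intro v
    let b := Module.finBasis ℝ S
    have hb : ∀ k, ContinuousOn
        (fun x ↦ b.equivFun (Δ.rep (P.trans j i x : Cl n) v) k) (P.U i ∩ P.U j) := by
      intro k
      let l : Cl n →ₗ[ℝ] ℝ :=
        { toFun := fun a ↦ b.equivFun (Δ.rep a v) k
          map_add' := by intro a c; simp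
          map_smul' := by intro r a; simp }
      have := (P.trans_smooth j i l).continuousOn
      rw [Set.inter_comm] at this
      exact this
    have h2 := continuousOn_pi.2 hb
    have h3 : Continuous b.equivFun.symm := LinearMap.continuous_of_finiteDimensional
      (b.equivFun.symm : (Fin (Module.finrank ℝ S) → ℝ) →ₗ[ℝ] S)
    refine (h3.comp_continuousOn h2).congr fun x _ ↦ ?_
    exact (b.equivFun.symm_apply_apply _).symm
  coordChange_comp i j k x hx v := by
    rw [← P.trans_cocycle k j i x ⟨⟨hx.2, hx.1.2⟩, hx.1.1⟩]
    simp

/-- The fibre of the spinor bundle at `x`. -/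
abbrev Spinor (x : N) : Type _ := (P.spinorCore Δ).Fiber x

variable {Δ}

/-- The representative in `Σₙ` of a spinor at `x`, with respect to the local section of `P_Spin`
chosen by `indexAt x`. -/
def toModel {x : N} (φ : P.Spinor Δ x) : S := φ

/-- The spinor at `x` with a given representative in `Σₙ`. -/
def ofModel {x : N} (s : S) : P.Spinor Δ x := s

/-- The Hermitian product `⟨φ, ψ⟩` of spinors, complex linear in the first entry and antilinear in
the second one (whereas Mathlib's `inner ℂ` is antilinear in the first entry). -/
def hermitian {x : N} (φ ψ : P.Spinor Δ x) : ℂ := inner ℂ (P.toModel ψ) (P.toModel φ)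

/-- The norm `|φ|` of a spinor. -/
def spinorNorm {x : N} (φ : P.Spinor Δ x) : ℝ := ‖P.toModel φ‖

/-- Coordinates of the tangent vector `V` with respect to the frame chosen by `indexAt x`. -/
def coord {x : N} (V : TangentSpace (𝓡 n) x) : EuclideanSpace ℝ (Fin n) :=
  WithLp.toLp 2 fun k ↦ inner ℝ (P.frame (P.indexAt x) k x) V

/-- Clifford multiplication `V · φ`. -/
def cliffordMul {x : N} (V : TangentSpace (𝓡 n) x) (φ : P.Spinor Δ x) : P.Spinor Δ x :=
  P.ofModel (Δ.rep (Cl.vec (P.coord V)) (P.toModel φ))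

/-- A spinor field is smooth if it is a smooth section of the spinor bundle. -/
def IsSmoothSpinor (φ : Π x : N, P.Spinor Δ x) : Prop :=
  ContMDiff (𝓡 n) ((𝓡 n).prod 𝓘(ℝ, S)) ∞ (fun x ↦ TotalSpace.mk' S x (φ x))

/-- The `Σₙ`-valued function representing the spinor field `φ` with respect to the local section
of `P_Spin` over `U j`. -/
def localRep (j : J) (φ : Π x : N, P.Spinor Δ x) (y : N) : S :=
  ((P.spinorCore Δ).localTriv j ⟨y, φ y⟩).2

/-- The coefficient `h(∇_X e_k, e_l)` of the Levi-Civita connection at `x`, for the frame `(e_k)`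
chosen by `indexAt x`. -/
def connectionForm {x : N} (X : TangentSpace (𝓡 n) x) (k l : Fin n) : ℝ :=
  ∑ m, P.coord X m * koszul (P.frame (P.indexAt x) m) (P.frame (P.indexAt x) k)
    (P.frame (P.indexAt x) l) x

/-- The covariant derivative `∇_X φ` of a spinor field at `x`, for the connection on the spinor
bundle induced by the Levi-Civita connection:
`∇_X φ = ∂_X φ + (1/4) ∑_{k,l} h(∇_X e_k, e_l) e_k · e_l · φ`
in the local trivialization around `x` given by the spin structure. (By the compatibility of the
transition functions the result does not depend on the trivialization.) -/
def spinDeriv (φ : Π x : N, P.Spinor Δ x) {x : N} (X : TangentSpace (𝓡 n) x) : P.Spinor Δ x :=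
  P.ofModel (mvfderiv (𝓡 n) (P.localRep (P.indexAt x) φ) x X) +
    (1 / 4 : ℂ) • ∑ k, ∑ l, (P.connectionForm X k l : ℂ) •
      P.cliffordMul (P.frame (P.indexAt x) k x) (P.cliffordMul (P.frame (P.indexAt x) l x) (φ x))

/-- The Dirac current `U_φ = ∑_k (-i ⟨e_k · φ, φ⟩) e_k`; see `inner_diracCurrent` for its
characterization. -/
def diracCurrent (φ : Π x : N, P.Spinor Δ x) (x : N) : TangentSpace (𝓡 n) x :=
  ∑ k, (-Complex.I * P.hermitian (P.cliffordMul (P.frame (P.indexAt x) k x) (φ x)) (φ x)).re •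
    P.frame (P.indexAt x) k x

/-- The function `q_φ = |φ|⁴ - |U_φ|²`. -/
def qInvariant (φ : Π x : N, P.Spinor Δ x) (x : N) : ℝ :=
  P.spinorNorm (φ x) ^ 4 - ‖P.diracCurrent φ x‖ ^ 2

/-- The spinor field `φ` is of type I if `q_φ = 0`. -/
def IsTypeI (φ : Π x : N, P.Spinor Δ x) : Prop := ∀ x, P.qInvariant φ x = 0

/-- `φ` is a generalized imaginary Killing spinor for the field `W` of symmetric endomorphisms of
the tangent bundle: `φ` and `W` are smooth, `W` is symmetric, and `∇_X φ = (i/2) W(X) · φ`. -/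
structure IsGeneralizedImaginaryKilling (φ : Π x : N, P.Spinor Δ x)
    (W : Π x : N, TangentSpace (𝓡 n) x →L[ℝ] TangentSpace (𝓡 n) x) : Prop where
  smooth_spinor : P.IsSmoothSpinor φ
  smooth_endo : ContMDiff (𝓡 n)
    ((𝓡 n).prod 𝓘(ℝ, EuclideanSpace ℝ (Fin n) →L[ℝ] EuclideanSpace ℝ (Fin n))) ∞
    (fun x ↦ TotalSpace.mk' (EuclideanSpace ℝ (Fin n) →L[ℝ] EuclideanSpace ℝ (Fin n))
      (E := fun x : N ↦ (TangentSpace (𝓡 n) x →L[ℝ] TangentSpace (𝓡 n) x)) x (W x))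
  symm : ∀ (x : N) (X Y : TangentSpace (𝓡 n) x), inner ℝ (W x X) Y = inner ℝ X (W x Y)
  killing : ∀ (x : N) (X : TangentSpace (𝓡 n) x),
    P.spinDeriv φ X = (Complex.I / 2) • P.cliffordMul (W x X) (φ x)

/-- The frames span the tangent spaces. -/
theorem sum_coord_smul {x : N} (V : TangentSpace (𝓡 n) x) :
    ∑ k, P.coord V k • P.frame (P.indexAt x) k x = V := by
  have ho := P.frame_orthonormal _ x (P.mem_indexAt x)
  have : FiniteDimensional ℝ (TangentSpace (𝓡 n) x) :=
    inferInstanceAs (FiniteDimensional ℝ (EuclideanSpace ℝ (Fin n)))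
  have hc : Fintype.card (Fin n) = Module.finrank ℝ (TangentSpace (𝓡 n) x) := by
    have : Module.finrank ℝ (TangentSpace (𝓡 n) x)
      = Module.finrank ℝ (EuclideanSpace ℝ (Fin n)) := rfl
    simp [this]
  have hs := ho.linearIndependent.span_eq_top_of_card_eq_finrank' hc
  let b := OrthonormalBasis.mk ho hs.ge
  have h := b.sum_repr' V
  simpa [b, coord] using h

/-- Clifford multiplication is real linear in the vector. -/
theorem cliffordMul_sum {x : N} (φ : P.Spinor Δ x) (c : Fin n → ℝ)
    (V : Fin n → TangentSpace (𝓡 n) x) :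
    P.toModel (P.cliffordMul (∑ k, c k • V k) φ)
      = ∑ k, (c k : ℂ) • P.toModel (P.cliffordMul (V k) φ) := by
  have h : P.coord (∑ k, c k • V k) = ∑ k, c k • P.coord (V k) := by
    ext m
    simp [coord, inner_sum, inner_smul_right]
  change Δ.rep (Cl.vec (P.coord (∑ k, c k • V k))) _
    = ∑ k, (c k : ℂ) • Δ.rep (Cl.vec (P.coord (V k))) _
  simp [h, map_sum]

/-- The Hermitian product `⟨V · φ, φ⟩` is purely imaginary. -/
theorem hermitian_cliffordMul_self_re {x : N} (V : TangentSpace (𝓡 n) x) (φ : P.Spinor Δ x) :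
    (P.hermitian (P.cliffordMul V φ) φ).re = 0 := by
  have h := congrArg Complex.re (Δ.skew (P.coord V) (P.toModel φ) (P.toModel φ))
  rw [← inner_conj_symm] at h
  simp only [Complex.conj_re, Complex.neg_re] at h
  change (inner ℂ (P.toModel φ) (Δ.rep (Cl.vec (P.coord V)) (P.toModel φ))).re = 0
  linarith

/-- The defining property `h(U_φ, X) = -i ⟨X · φ, φ⟩` of the Dirac current. -/
theorem inner_diracCurrent (φ : Π x : N, P.Spinor Δ x) {x : N} (X : TangentSpace (𝓡 n) x) :
    ((inner ℝ (P.diracCurrent φ x) X : ℝ) : ℂ) =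
      -Complex.I * P.hermitian (P.cliffordMul X (φ x)) (φ x) := by
  have hX : P.hermitian (P.cliffordMul X (φ x)) (φ x)
      = ∑ k, (P.coord X k : ℂ) *
        P.hermitian (P.cliffordMul (P.frame (P.indexAt x) k x) (φ x)) (φ x) := by
    conv_lhs => rw [← P.sum_coord_smul X]
    simp only [hermitian, cliffordMul_sum, inner_sum, inner_smul_right]
  rw [hX, diracCurrent, sum_inner, Finset.mul_sum, Complex.ofReal_sum]
  refine Finset.sum_congr rfl fun k _ ↦ ?_
  rw [real_inner_smul_left]
  have hre := P.hermitian_cliffordMul_self_re (P.frame (P.indexAt x) k x) (φ x)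
  apply Complex.ext <;> simp [hre, coord, mul_comm]

end SpinStructure

end Manifold

end

/-! At a single point, Cauchy–Schwarz and `norm_rep_vec` give |U| ≤ |φ|², and (a), (b), (c) are
equivalent there: equality forces U·φ = i|U|φ, and conversely iφ = V·φ with φ ≠ 0 forces |V| = 1 and
h(U,V) = |φ|². Condition (d) is weaker pointwise, since it says nothing where U = 0.

The gap is closed by the Killing equation, which gives d|φ|²(X) = -h(U, WX) and ∇_X U = -|φ|² W(X).
The two contributions to dq cancel, so q is constant on the connected manifold (`qInvariant_eq`). If
U is nonzero somewhere, (d) gives q = 0 there, hence everywhere. If U ≡ 0, then |φ|² is constant and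
|φ|² W = 0, so W ≢ 0 forces φ ≡ 0 (`toModel_eq_zero`).

Derivatives are computed in a local trivialization, for functions on the fixed space `S`. -/

namespace SpinorModule

variable {n : ℕ} {S : Type*} [NormedAddCommGroup S] [InnerProductSpace ℂ S] (Δ : SpinorModule n S)

/-! ### Clifford relations and unitarity of the spin action. -/

theorem rep_vec_rep_vec (v : EuclideanSpace ℝ (Fin n)) (s : S) :
    Δ.rep (Cl.vec v) (Δ.rep (Cl.vec v) s) = (-(‖v‖ : ℂ) ^ 2) • s := by
  have h : Δ.rep (Cl.vec v * Cl.vec v) s = (-(‖v‖ : ℂ) ^ 2) • s := by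
    rw [Cl.vec, CliffordAlgebra.ι_sq_scalar, AlgHom.commutes, cliffordForm_apply,
      Algebra.algebraMap_eq_smul_one, smul_apply]
    rw [← Complex.coe_smul]
    simp
  rwa [map_mul] at h

/-- Polarization of `rep_vec_rep_vec`. -/
theorem rep_vec_anticomm (v w : EuclideanSpace ℝ (Fin n)) (s : S) :
    Δ.rep (Cl.vec v) (Δ.rep (Cl.vec w) s) =
      -Δ.rep (Cl.vec w) (Δ.rep (Cl.vec v) s) - ((2 * inner ℝ v w : ℝ) : ℂ) • s := by
  have h := Δ.rep_vec_rep_vec (v + w) s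
  simp only [map_add, add_apply, rep_vec_rep_vec] at h
  have hn : (‖v + w‖ : ℂ) ^ 2 = (‖v‖ : ℂ) ^ 2 + 2 * (inner ℝ v w : ℝ) + (‖w‖ : ℂ) ^ 2 := by
    exact_mod_cast norm_add_sq_real v w
  rw [hn] at h
  have h2 : Δ.rep (Cl.vec v) (Δ.rep (Cl.vec w) s) + Δ.rep (Cl.vec w) (Δ.rep (Cl.vec v) s) =
      -((2 * inner ℝ v w : ℝ) : ℂ) • s := by
    push_cast
    linear_combination (norm := module) h
  linear_combination (norm := module) h2

/-- `star` negates vectors and reverses products, so skew-adjointness of vectors propagates to the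
whole algebra. Unitarity of `Spin n` follows. -/
theorem inner_rep_left (a : Cl n) (s t : S) :
    inner ℂ (Δ.rep a s) t = inner ℂ s (Δ.rep (star a) t) := by
  induction a using CliffordAlgebra.induction generalizing s t with
  | algebraMap r =>
    rw [CliffordAlgebra.star_algebraMap, AlgHom.commutes, Algebra.algebraMap_eq_smul_one,
      smul_apply, smul_apply, ← Complex.coe_smul,
      ← Complex.coe_smul]
    rw [inner_smul_left, inner_smul_right, Complex.conj_ofReal]
    rfl
  | ι v =>
    rw [CliffordAlgebra.star_ι, map_neg, neg_apply, inner_neg_right]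
    exact Δ.skew v s t
  | mul a b ha hb => simp [ha, hb]
  | add a b ha hb => simp only [map_add, star_add, add_apply, inner_add_left, inner_add_right, ha, hb]

theorem rep_star_rep (g : Spin n) (s : S) : Δ.rep (star (g : Cl n)) (Δ.rep (g : Cl n) s) = s := by
  have h : Δ.rep (star (g : Cl n) * (g : Cl n)) s = s := by
    rw [spinGroup.star_mul_self_of_mem g.2]
    simp
  rwa [map_mul] at h

theorem inner_rep_spin (g : Spin n) (s t : S) :
    inner ℂ (Δ.rep (g : Cl n) s) (Δ.rep (g : Cl n) t) = inner ℂ s t := by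
  rw [inner_rep_left, rep_star_rep]

theorem norm_rep_spin (g : Spin n) (s : S) : ‖Δ.rep (g : Cl n) s‖ = ‖s‖ := by
  have h := Δ.inner_rep_spin g s s
  rw [inner_self_eq_norm_sq_to_K, inner_self_eq_norm_sq_to_K] at h
  have h' : ‖Δ.rep (g : Cl n) s‖ ^ 2 = ‖s‖ ^ 2 := by exact_mod_cast h
  exact (sq_eq_sq₀ (norm_nonneg _) (norm_nonneg _)).1 h'

/-- The component `-i ⟨v · s, s⟩` of the Dirac current of `s` along `v`. -/
noncomputable def current (s : S) (v : EuclideanSpace ℝ (Fin n)) : ℝ := (inner ℂ s (Δ.rep (Cl.vec v) s)).im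

theorem inner_rep_vec_self (s : S) (v : EuclideanSpace ℝ (Fin n)) :
    inner ℂ s (Δ.rep (Cl.vec v) s) = Complex.I * (Δ.current s v : ℂ) := by
  have h := congrArg Complex.re (Δ.skew v s s)
  rw [← inner_conj_symm] at h
  simp only [Complex.conj_re, Complex.neg_re] at h
  apply Complex.ext
  · simp; linarith
  · simp [current]

theorem norm_rep_vec (s : S) (v : EuclideanSpace ℝ (Fin n)) :
    ‖Δ.rep (Cl.vec v) s‖ = ‖v‖ * ‖s‖ := by
  have h := Δ.skew v s (Δ.rep (Cl.vec v) s)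
  rw [rep_vec_rep_vec, inner_smul_right, inner_self_eq_norm_sq_to_K,
    inner_self_eq_norm_sq_to_K] at h
  have h' : ‖Δ.rep (Cl.vec v) s‖ ^ 2 = (‖v‖ * ‖s‖) ^ 2 := by
    have h2 : (‖Δ.rep (Cl.vec v) s‖ : ℂ) ^ 2 = ((‖v‖ : ℂ) * ‖s‖) ^ 2 := by
      refine h.trans ?_
      simp only [Complex.coe_algebraMap]
      ring
    exact_mod_cast h2
  exact (sq_eq_sq₀ (norm_nonneg _) (by positivity)).1 h'

/-! ### Pointwise comparison of the Dirac current with the squared norm. -/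

section Pointwise

variable {Δ} {s : S} {u : EuclideanSpace ℝ (Fin n)}

theorem norm_current_le
    (hu : ∀ v, inner ℝ u v = Δ.current s v) : ‖u‖ ≤ ‖s‖ ^ 2 := by
  rcases eq_or_ne u 0 with rfl | h0
  · simp
  have h1 : ‖u‖ ^ 2 ≤ ‖s‖ * (‖u‖ * ‖s‖) := by
    rw [← real_inner_self_eq_norm_sq, hu, ← norm_rep_vec Δ]
    exact ((le_abs_self _).trans (Complex.abs_im_le_norm _)).trans (norm_inner_le_norm _ _)
  have h2 : 0 < ‖u‖ := norm_pos_iff.2 h0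
  nlinarith

theorem rep_current_self
    (hu : ∀ v, inner ℝ u v = Δ.current s v)
    (h : ‖u‖ = ‖s‖ ^ 2) :
    Δ.rep (Cl.vec u) s = (Complex.I * (‖u‖ : ℂ)) • s := by
  have h1 : inner ℂ s (Δ.rep (Cl.vec u) s) = Complex.I * ((‖u‖ ^ 2 : ℝ) : ℂ) := by
    rw [inner_rep_vec_self, ← hu, real_inner_self_eq_norm_sq]
  -- Expanding |u·s - i|u|s|² gives 2|u|²|s|² - 2|u|³, which vanishes because |u| = |s|².
  rw [← sub_eq_zero, ← norm_eq_zero, ← sq_eq_zero_iff, norm_sub_sq (𝕜 := ℂ), norm_rep_vec,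
    norm_smul, inner_smul_right, ← inner_conj_symm, h1]
  simp
  rw [← Complex.ofReal_pow, Complex.ofReal_re, mul_pow, ← h]
  ring

theorem rep_smul_current_self
    (hu : ∀ v, inner ℝ u v = Δ.current s v)
    (h : ‖u‖ = ‖s‖ ^ 2) : Complex.I • s = Δ.rep (Cl.vec (‖u‖⁻¹ • u)) s := by
  -- For s = 0 also u = 0 and the inverse takes its default value 0, but both sides vanish with s.
  rcases eq_or_ne s 0 with rfl | h0
  · simp
  have h1 : (‖u‖ : ℂ) ≠ 0 := by
    rw [h]
    simpa using h0
  rw [map_smul, map_smul, smul_apply, rep_current_self hu h, ← Complex.coe_smul, smul_smul]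
  congr 1
  push_cast
  field_simp

theorem norm_current_eq_of_rep_self
    (hu : ∀ v, inner ℝ u v = Δ.current s v)
    (h0 : u ≠ 0)
    (h : Δ.rep (Cl.vec u) s = (Complex.I * (‖u‖ : ℂ)) • s) : ‖u‖ = ‖s‖ ^ 2 := by
  have h1 := hu u
  rw [current, h, inner_smul_right, real_inner_self_eq_norm_sq, inner_self_eq_norm_sq_to_K] at h1
  simp [← Complex.ofReal_pow] at h1
  have h2 : 0 < ‖u‖ := norm_pos_iff.2 h0
  nlinarith

theorem norm_current_eq_of_rep_eq
    (hu : ∀ v, inner ℝ u v = Δ.current s v) {v : EuclideanSpace ℝ (Fin n)}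
    (h : Complex.I • s = Δ.rep (Cl.vec v) s) : ‖u‖ = ‖s‖ ^ 2 := by
  refine le_antisymm (norm_current_le hu) ?_
  rcases eq_or_ne s 0 with rfl | h0
  · simp
  have h1 := hu v
  rw [current, ← h, inner_smul_right, inner_self_eq_norm_sq_to_K] at h1
  simp [← Complex.ofReal_pow] at h1
  have h2 := norm_rep_vec Δ s v
  rw [← h, norm_smul, Complex.norm_I, one_mul] at h2
  -- Comparing norms in i s = v·s shows that v is a unit vector, so |s|² = ⟨u, v⟩ ≤ |u|.
  have h3 : ‖v‖ = 1 := by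
    have : ‖s‖ ≠ 0 := norm_ne_zero_iff.2 h0
    exact mul_right_cancel₀ this (by linarith)
  rw [← h1]
  simpa [h3] using real_inner_le_norm u v

end Pointwise

/-! ### Differentiation on the spinor module. -/

/-- Clifford multiplication by the `k`-th standard basis vector of `ℝⁿ`. -/
noncomputable abbrev gam (k : Fin n) : S →L[ℂ] S := Δ.rep (Cl.vec (EuclideanSpace.single k 1))

/-- The action `∑ A_kl e_k · e_l` of a matrix on spinors. -/
noncomputable def conn (A : Fin n → Fin n → ℝ) (s : S) : S :=
  ∑ k, ∑ l, (A k l : ℂ) • Δ.gam k (Δ.gam l s)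

variable {A : Fin n → Fin n → ℝ}

/-- The adjoint of e_k·e_l is e_l·e_k, so antisymmetry of A makes the operator skew-adjoint: the
spin connection is metric. -/
theorem inner_conn_left (hA : ∀ k l, A k l = -A l k) (s t : S) :
    inner ℂ (Δ.conn A s) t = -inner ℂ s (Δ.conn A t) := by
  simp only [conn, sum_inner, inner_sum, inner_smul_left, inner_smul_right, Complex.conj_ofReal,
    Δ.skew, neg_neg]
  rw [Finset.sum_comm, ← Finset.sum_neg_distrib]
  refine Finset.sum_congr rfl fun k _ ↦ ?_
  rw [← Finset.sum_neg_distrib]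
  refine Finset.sum_congr rfl fun l _ ↦ ?_
  rw [hA l k]
  push_cast
  ring

theorem gam_gam_gam (k a b : Fin n) (s : S) :
    Δ.gam k (Δ.gam a (Δ.gam b s)) = Δ.gam a (Δ.gam b (Δ.gam k s))
      - (if k = a then (2 : ℂ) else 0) • Δ.gam b s + (if k = b then (2 : ℂ) else 0) • Δ.gam a s := by
  rw [rep_vec_anticomm, Δ.rep_vec_anticomm (EuclideanSpace.single k 1)
    (EuclideanSpace.single b 1) s, map_sub, map_neg, map_smul]
  simp only [EuclideanSpace.inner_single_left, PiLp.single_apply, map_one, one_mul]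
  split_ifs <;> simp <;> module

/-- The commutator of a vector with a bivector is again a vector. The factor 4 cancels the 1/4 of
the spin connection, which expresses its compatibility with Clifford multiplication. -/
theorem gam_conn (hA : ∀ k l, A k l = -A l k) (k : Fin n) (s : S) :
    Δ.gam k (Δ.conn A s) = Δ.conn A (Δ.gam k s) - (4 : ℂ) • ∑ b, (A k b : ℂ) • Δ.gam b s := by
  have h1 : Δ.gam k (Δ.conn A s) = Δ.conn A (Δ.gam k s)
      - ∑ a, ∑ b, (A a b : ℂ) • ((if k = a then (2 : ℂ) else 0) • Δ.gam b s)
      + ∑ a, ∑ b, (A a b : ℂ) • ((if k = b then (2 : ℂ) else 0) • Δ.gam a s) := by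
    simp only [conn, map_sum, map_smul]
    simp_rw [← Finset.sum_sub_distrib, ← Finset.sum_add_distrib]
    refine Finset.sum_congr rfl fun a _ ↦ Finset.sum_congr rfl fun b _ ↦ ?_
    rw [gam_gam_gam, smul_add, smul_sub]
  have h2 : ∑ a, ∑ b, (A a b : ℂ) • ((if k = a then (2 : ℂ) else 0) • Δ.gam b s)
      = (2 : ℂ) • ∑ b, (A k b : ℂ) • Δ.gam b s := by
    rw [Finset.sum_eq_single k (by intro a _ ha; simp [Ne.symm ha]) (by simp), Finset.smul_sum]
    exact Finset.sum_congr rfl fun b _ ↦ by rw [if_pos rfl, smul_comm]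
  have h3 : ∑ a, ∑ b, (A a b : ℂ) • ((if k = b then (2 : ℂ) else 0) • Δ.gam a s)
      = -((2 : ℂ) • ∑ b, (A k b : ℂ) • Δ.gam b s) := by
    rw [Finset.sum_comm, Finset.sum_eq_single k (by intro a _ ha; simp [Ne.symm ha]) (by simp),
      Finset.smul_sum, ← Finset.sum_neg_distrib]
    refine Finset.sum_congr rfl fun b _ ↦ ?_
    rw [if_pos rfl, smul_comm, hA b k]
    simp
  rw [h1, h2, h3]
  module

theorem current_eq_sum (s : S) (v : EuclideanSpace ℝ (Fin n)) :
    Δ.current s v = ∑ k, v k * Δ.current s (EuclideanSpace.single k 1) := by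
  have hv : v = ∑ k, v k • EuclideanSpace.single k (1 : ℝ) := by
    simpa using ((EuclideanSpace.basisFun (Fin n) ℝ).sum_repr v).symm
  have h : Δ.rep (Cl.vec v) s = ∑ k, (v k : ℂ) • Δ.gam k s := by
    conv_lhs => rw [hv]
    simp [map_sum, gam]
  rw [current, h, inner_sum, Complex.im_sum]
  exact Finset.sum_congr rfl fun k _ ↦ by rw [inner_smul_right, Complex.im_ofReal_mul]; rfl

/-- The derivative of a generalized imaginary Killing spinor in a local trivialization. -/
noncomputable def killingDeriv (A : Fin n → Fin n → ℝ) (w : EuclideanSpace ℝ (Fin n)) (s : S) : S :=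
  (Complex.I / 2) • Δ.rep (Cl.vec w) s - (1 / 4 : ℂ) • Δ.conn A s

theorem re_inner_killingDeriv (hA : ∀ k l, A k l = -A l k) (w : EuclideanSpace ℝ (Fin n)) (s : S) :
    (inner ℂ s (Δ.killingDeriv A w s)).re = -(1 / 2) * Δ.current s w := by
  have h1 := congrArg Complex.re (Δ.inner_conn_left hA s s)
  rw [← inner_conj_symm] at h1
  simp only [Complex.conj_re, Complex.neg_re] at h1
  have h2 : (inner ℂ s (Δ.conn A s)).re = 0 := by linarith
  rw [killingDeriv, inner_sub_right, inner_smul_right, inner_smul_right, inner_rep_vec_self]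
  have h3 : Complex.I / 2 * (Complex.I * (Δ.current s w : ℂ)) =
      ((-(1 / 2) * Δ.current s w : ℝ) : ℂ) := by
    push_cast
    linear_combination (1 / 2 * (Δ.current s w : ℂ)) * Complex.I_mul_I
  rw [h3, Complex.sub_re, Complex.ofReal_re, Complex.mul_re, h2]
  simp

/-- This is the k-th frame component of ∇_X U = -|φ|² W(X), written as an ordinary derivative; the
sum over b is the Levi-Civita correction. -/
theorem im_inner_killingDeriv (hA : ∀ k l, A k l = -A l k) (w : EuclideanSpace ℝ (Fin n)) (s : S)
    (k : Fin n) :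
    (inner ℂ (Δ.killingDeriv A w s) (Δ.gam k s) + inner ℂ s (Δ.gam k (Δ.killingDeriv A w s))).im =
      -‖s‖ ^ 2 * w k + ∑ b, A k b * Δ.current s (EuclideanSpace.single b 1) := by
  have h0 : inner ℂ s s = (‖s‖ : ℂ) ^ 2 := inner_self_eq_norm_sq_to_K s
  have h1 : inner ℂ (Δ.killingDeriv A w s) (Δ.gam k s)
      + inner ℂ s (Δ.gam k (Δ.killingDeriv A w s)) =
      Complex.I * ((-‖s‖ ^ 2 * w k + ∑ b, A k b * Δ.current s (EuclideanSpace.single b 1) : ℝ) : ℂ)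
      := by
    have h2 : inner ℂ s (Δ.gam k (Δ.conn A s)) = inner ℂ s (Δ.conn A (Δ.gam k s))
        - 4 * ∑ b, (A k b : ℂ) * (Complex.I * (Δ.current s (EuclideanSpace.single b 1) : ℂ)) := by
      rw [gam_conn Δ hA, inner_sub_right, inner_smul_right, inner_sum]
      simp only [inner_smul_right, inner_rep_vec_self]
    have h3 : inner ℂ s (Δ.gam k (Δ.rep (Cl.vec w) s)) =
        -inner ℂ s (Δ.rep (Cl.vec w) (Δ.gam k s)) - 2 * w k * (‖s‖ : ℂ) ^ 2 := by
      rw [rep_vec_anticomm, inner_sub_right, inner_neg_right, inner_smul_right, h0,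
        EuclideanSpace.inner_single_left]
      simp
    simp only [killingDeriv, inner_sub_left, inner_smul_left, map_sub, map_smul, inner_sub_right,
      inner_smul_right, Δ.inner_conn_left hA, Δ.skew w, h2, h3, map_div₀, Complex.conj_I,
      map_ofNat, map_one]
    push_cast
    have h4 : ∑ b, (A k b : ℂ) * (Complex.I * (Δ.current s (EuclideanSpace.single b 1) : ℂ)) =
        Complex.I * ∑ b, (A k b : ℂ) * (Δ.current s (EuclideanSpace.single b 1) : ℂ) := by
      rw [Finset.mul_sum]
      exact Finset.sum_congr rfl fun b _ ↦ by ring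
    rw [h4]
    ring
  rw [h1, Complex.I_mul_im, Complex.ofReal_re]

theorem hasFDerivAt_current (v : EuclideanSpace ℝ (Fin n)) (s : S) :
    ∃ L : S →L[ℝ] ℝ, HasFDerivAt (fun s ↦ Δ.current s v) L s ∧
      ∀ t, L t = (inner ℂ t (Δ.rep (Cl.vec v) s) + inner ℂ s (Δ.rep (Cl.vec v) t)).im := by
  have h1 : HasFDerivAt (fun s : S ↦ Δ.rep (Cl.vec v) s)
      ((Δ.rep (Cl.vec v)).restrictScalars ℝ) s :=
    ((Δ.rep (Cl.vec v)).restrictScalars ℝ).hasFDerivAt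
  have h2 := Complex.imCLM.hasFDerivAt.comp s ((hasFDerivAt_id (𝕜 := ℝ) s).inner ℂ h1)
  refine ⟨_, h2, fun t ↦ ?_⟩
  simp [fderivInnerCLM_apply, add_comm]

theorem hasFDerivAt_norm_sq_spinor (s : S) :
    ∃ L : S →L[ℝ] ℝ, HasFDerivAt (fun s : S ↦ ‖s‖ ^ 2) L s ∧ ∀ t, L t = 2 * (inner ℂ s t).re := by
  have h := Complex.reCLM.hasFDerivAt.comp s
    ((hasFDerivAt_id (𝕜 := ℝ) s).inner ℂ (hasFDerivAt_id (𝕜 := ℝ) s))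
  refine ⟨_, h.congr_of_eventuallyEq (.of_forall fun t ↦ ?_), fun t ↦ ?_⟩
  · simp [← Complex.ofReal_pow]
  · have := inner_re_symm (𝕜 := ℂ) s t
    simp [fderivInnerCLM_apply] at this ⊢
    linarith

/-- The function `|s|⁴ - |U_s|²` on the spinor module. -/
noncomputable def quartic (s : S) : ℝ := (‖s‖ ^ 2) ^ 2 - ∑ k, Δ.current s (EuclideanSpace.single k 1) ^ 2

/-- Only the values of the differential on Killing directions matter. There the norm contributes
-2|s|²⟨U, w⟩, the current contributes the same amount with opposite sign, and the connection terms
cancel. -/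
theorem hasFDerivAt_quartic (s : S) :
    ∃ L : S →L[ℝ] ℝ, HasFDerivAt Δ.quartic L s ∧
      ∀ A w, (∀ k l, A k l = -A l k) → L (Δ.killingDeriv A w s) = 0 := by
  obtain ⟨L, hL, hL'⟩ := hasFDerivAt_norm_sq_spinor s
  choose M hM hM' using fun k : Fin n ↦ Δ.hasFDerivAt_current (EuclideanSpace.single k 1) s
  refine ⟨_, (hL.pow 2).sub (HasFDerivAt.fun_sum (u := Finset.univ) fun k _ ↦ (hM k).pow 2),
    fun A w hA ↦ ?_⟩
  have h3 : ∑ k, Δ.current s (EuclideanSpace.single k 1) *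
      ∑ b, A k b * Δ.current s (EuclideanSpace.single b 1) = 0 := by
    have : ∀ x : ℝ, x = -x → x = 0 := fun x hx ↦ by linarith
    -- Exchanging the two summation indices turns the sum into its negative.
    refine this _ ?_
    simp only [Finset.mul_sum]
    conv_lhs => rw [Finset.sum_comm]
    rw [← Finset.sum_neg_distrib]
    refine Finset.sum_congr rfl fun k _ ↦ ?_
    rw [← Finset.sum_neg_distrib]
    refine Finset.sum_congr rfl fun l _ ↦ ?_
    rw [hA l k]
    ring
  have h4 : ∑ k, 2 * Δ.current s (EuclideanSpace.single k 1) *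
      (-‖s‖ ^ 2 * w k + ∑ b, A k b * Δ.current s (EuclideanSpace.single b 1)) =
      -2 * ‖s‖ ^ 2 * Δ.current s w := by
    rw [Δ.current_eq_sum s w, Finset.mul_sum]
    refine Eq.trans ?_ ((congrArg₂ (· + ·) rfl ((congrArg (2 * ·) h3).trans (mul_zero _))).trans (add_zero _))
    simp only [Finset.mul_sum, ← Finset.sum_add_distrib, mul_add]
    exact Finset.sum_congr rfl fun k _ ↦ congrArg₂ (· + ·) (by ring)
      (Finset.sum_congr rfl fun l _ ↦ by ring)
  simp [hL', hM', Δ.re_inner_killingDeriv hA]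
  simp only [← Complex.add_im, Δ.im_inner_killingDeriv hA]
  rw [h4]
  ring

end SpinorModule

/-! ### Functions with zero differential, and antisymmetry of the Levi-Civita coefficients. -/

section Manifold

variable {n : ℕ} {N : Type*} [TopologicalSpace N]
  [ChartedSpace (EuclideanSpace ℝ (Fin n)) N]

theorem eq_of_forall_hasMFDerivAt_zero [IsManifold (𝓡 n) ∞ N] [ConnectedSpace N] {f : N → ℝ}
    (hf : ∀ x, HasMFDerivAt (𝓡 n) 𝓘(ℝ, ℝ) f x 0) (x y : N) : f x = f y := by
  refine IsLocallyConstant.apply_eq_of_preconnectedSpace (f := f)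
    ((IsLocallyConstant.iff_eventually_eq f).2 fun x ↦ ?_) x y
  let e := extChartAt (𝓡 n) x
  have ho : IsOpen e.target := isOpen_extChartAt_target x
  have hd : ∀ z ∈ e.target, HasFDerivAt (f ∘ e.symm) (0 : EuclideanSpace ℝ (Fin n) →L[ℝ] ℝ) z := by
    intro z hz
    have h1 : MDifferentiableAt 𝓘(ℝ, EuclideanSpace ℝ (Fin n)) (𝓡 n) e.symm z :=
      ((contMDiffOn_extChartAt_symm (n := ∞) x).contMDiffAt (ho.mem_nhds hz)).mdifferentiableAt
        (by simp)
    have h2 := (hf (e.symm z)).comp z h1.hasMFDerivAt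
    rw [ContinuousLinearMap.zero_comp] at h2
    exact h2.hasFDerivAt
  -- The chart target need not be connected, so the argument is confined to a ball.
  obtain ⟨r, hr, hb⟩ := Metric.isOpen_iff.1 ho (e x) (mem_extChartAt_target x)
  have hn : ∀ᶠ y in nhds x, e y ∈ Metric.ball (e x) r :=
    (continuousAt_extChartAt x).eventually_mem (Metric.ball_mem_nhds _ hr)
  filter_upwards [hn, extChartAt_source_mem_nhds (I := 𝓡 n) x] with y hy hys
  have h := Metric.isOpen_ball.is_const_of_fderiv_eq_zero (𝕜 := ℝ)
    (convex_ball (e x) r).isPreconnected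
    (fun z hz ↦ (hd z (hb hz)).differentiableAt.differentiableWithinAt)
    (fun z hz ↦ (hd z (hb hz)).fderiv) hy (Metric.mem_ball_self hr)
  rwa [Function.comp_apply, Function.comp_apply, e.left_inv hys,
    e.left_inv (mem_extChartAt_source x)] at h

variable [RiemannianBundle (fun x : N ↦ TangentSpace (𝓡 n) x)]

theorem koszul_add_koszul_swap (X Y Z : Π x : N, TangentSpace (𝓡 n) x) (x : N) :
    koszul X Y Z x + koszul X Z Y x =
      mvfderiv (𝓡 n) (fun y ↦ inner ℝ (Y y) (Z y)) x (X x) := by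
  have h : (fun y ↦ inner ℝ (Z y) (Y y)) = fun y ↦ inner ℝ (Y y) (Z y) :=
    funext fun y ↦ real_inner_comm _ _
  rw [koszul, koszul, h, VectorField.mlieBracket_swap_apply (V := Z) (W := Y), inner_neg_left]
  ring

/-- Metric compatibility applied to fields whose inner product is locally constant, as for an
orthonormal frame. -/
theorem koszul_antisymm {X Y Z : Π x : N, TangentSpace (𝓡 n) x} {x : N} {c : ℝ}
    (h : ∀ᶠ y in nhds x, inner ℝ (Y y) (Z y) = c) : koszul X Y Z x = -koszul X Z Y x := by
  have h0 : mvfderiv (𝓡 n) (fun y ↦ inner ℝ (Y y) (Z y)) x = 0 := by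
    rw [mvfderiv, Filter.EventuallyEq.mfderiv_eq (f := fun _ ↦ c) h, mfderiv_const]
    rfl
  have := koszul_add_koszul_swap X Y Z x
  rw [h0] at this
  simp at this
  linarith

variable [IsManifold (𝓡 n) ∞ N]

/-! ### Spinors and the Dirac current in local frames. -/

namespace SpinStructure

variable {J : Type*} (P : SpinStructure n N J)

theorem connectionForm_antisymm {x : N} (X : TangentSpace (𝓡 n) x) (k l : Fin n) :
    P.connectionForm X k l = -P.connectionForm X l k := by
  rw [connectionForm, connectionForm, ← Finset.sum_neg_distrib]
  refine Finset.sum_congr rfl fun m _ ↦ ?_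
  rw [koszul_antisymm (c := if k = l then 1 else 0)]
  · ring
  · filter_upwards [(P.isOpen_U _).mem_nhds (P.mem_indexAt x)] with y hy
    exact orthonormal_iff_ite.1 (P.frame_orthonormal _ y hy) k l

theorem coord_frame {x : N} (k : Fin n) :
    P.coord (P.frame (P.indexAt x) k x) = EuclideanSpace.single k 1 := by
  ext l
  simpa [coord, PiLp.single_apply] using
    orthonormal_iff_ite.1 (P.frame_orthonormal _ x (P.mem_indexAt x)) l k

theorem inner_coord {x : N} (V V' : TangentSpace (𝓡 n) x) :
    inner ℝ (P.coord V) (P.coord V') = inner ℝ V V' := by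
  conv_rhs => rw [← P.sum_coord_smul V]
  rw [sum_inner, PiLp.inner_apply]
  refine Finset.sum_congr rfl fun k _ ↦ ?_
  rw [real_inner_smul_left, mul_comm]
  rfl

theorem norm_coord {x : N} (V : TangentSpace (𝓡 n) x) : ‖P.coord V‖ = ‖V‖ := by
  rw [@norm_eq_sqrt_real_inner, @norm_eq_sqrt_real_inner _ _ _ V, inner_coord]

theorem coord_smul {x : N} (c : ℝ) (V : TangentSpace (𝓡 n) x) :
    P.coord (c • V) = c • P.coord V := by
  ext k
  simp [coord, inner_smul_right]

theorem coord_sum_smul_frame {x : N} (v : EuclideanSpace ℝ (Fin n)) :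
    P.coord (∑ k, v k • P.frame (P.indexAt x) k x) = v := by
  ext l
  simpa [coord, mul_comm] using
    (P.frame_orthonormal _ x (P.mem_indexAt x)).inner_right_fintype (fun k ↦ v k) l

variable {S : Type*} [NormedAddCommGroup S] [InnerProductSpace ℂ S] [FiniteDimensional ℂ S]
  {Δ : SpinorModule n S}

theorem inner_diracCurrent_eq_current (φ : Π x : N, P.Spinor Δ x) {x : N}
    (V : TangentSpace (𝓡 n) x) :
    inner ℝ (P.diracCurrent φ x) V = Δ.current (P.toModel (φ x)) (P.coord V) := by
  have h := P.inner_diracCurrent φ V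
  have h2 : P.hermitian (P.cliffordMul V (φ x)) (φ x) =
      Complex.I * (Δ.current (P.toModel (φ x)) (P.coord V) : ℂ) :=
    Δ.inner_rep_vec_self _ _
  rw [h2, ← mul_assoc, neg_mul, Complex.I_mul_I, neg_neg, one_mul] at h
  exact_mod_cast h

theorem inner_coord_diracCurrent (φ : Π x : N, P.Spinor Δ x) (x : N)
    (v : EuclideanSpace ℝ (Fin n)) :
    inner ℝ (P.coord (P.diracCurrent φ x)) v = Δ.current (P.toModel (φ x)) v := by
  rw [← P.coord_sum_smul_frame (x := x) v, inner_coord, inner_diracCurrent_eq_current]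

theorem localRep_apply (φ : Π x : N, P.Spinor Δ x) (j : J) (y : N) :
    P.localRep j φ y = Δ.rep (P.trans j (P.indexAt y) y : Cl n) (P.toModel (φ y)) := rfl

theorem localRep_indexAt (φ : Π x : N, P.Spinor Δ x) (x : N) :
    P.localRep (P.indexAt x) φ x = P.toModel (φ x) := by
  rw [localRep_apply, P.trans_self _ x (P.mem_indexAt x)]
  simp

/-- `trans` takes values in `Spin n` even off the overlaps, so y may be arbitrary. -/
theorem norm_localRep (φ : Π x : N, P.Spinor Δ x) (j : J) (y : N) :
    ‖P.localRep j φ y‖ = P.spinorNorm (φ y) := by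
  rw [localRep_apply, Δ.norm_rep_spin]
  rfl

/-- The change of frame conjugates Clifford multiplication by a spin element, which acts unitarily.
The index j can thus stay fixed while y varies, whereas `indexAt y` need not depend continuously on
y. -/
theorem current_localRep (φ : Π x : N, P.Spinor Δ x) {j : J} {y : N} (hy : y ∈ P.U j) (k : Fin n) :
    Δ.current (P.localRep j φ y) (EuclideanSpace.single k 1) =
      inner ℝ (P.diracCurrent φ y) (P.frame j k y) := by
  have h := P.trans_frame j (P.indexAt y) y ⟨hy, P.mem_indexAt y⟩ (P.frame j k y)
  have h1 : (WithLp.toLp 2 fun l ↦ inner ℝ (P.frame j l y) (P.frame j k y)) =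
      EuclideanSpace.single k (1 : ℝ) := by
    ext l
    simpa [PiLp.single_apply] using orthonormal_iff_ite.1 (P.frame_orthonormal _ y hy) l k
  rw [h1] at h
  rw [inner_diracCurrent_eq_current, SpinorModule.current, h, map_mul, map_mul, localRep_apply]
  change (inner ℂ _ (Δ.rep _ (Δ.rep _ (Δ.rep _ (Δ.rep _ _))))).im = _
  rw [Δ.rep_star_rep, Δ.inner_rep_spin]
  rfl

theorem qInvariant_eq_quartic (φ : Π x : N, P.Spinor Δ x) {j : J} {y : N} (hy : y ∈ P.U j) :
    P.qInvariant φ y = Δ.quartic (P.localRep j φ y) := by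
  have ho := P.frame_orthonormal j y hy
  have : FiniteDimensional ℝ (TangentSpace (𝓡 n) y) :=
    inferInstanceAs (FiniteDimensional ℝ (EuclideanSpace ℝ (Fin n)))
  have hc : Fintype.card (Fin n) = Module.finrank ℝ (TangentSpace (𝓡 n) y) := by
    have : Module.finrank ℝ (TangentSpace (𝓡 n) y)
      = Module.finrank ℝ (EuclideanSpace ℝ (Fin n)) := rfl
    simp [this]
  have hs := ho.linearIndependent.span_eq_top_of_card_eq_finrank' hc
  have h := (OrthonormalBasis.mk ho hs.ge).sum_sq_inner_left (P.diracCurrent φ y)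
  rw [OrthonormalBasis.coe_mk] at h
  rw [qInvariant, SpinorModule.quartic, norm_localRep, ← h]
  simp only [P.current_localRep φ hy]
  ring

theorem mdifferentiableAt_localRep {φ : Π x : N, P.Spinor Δ x} (h : P.IsSmoothSpinor φ) (x : N) :
    MDifferentiableAt (𝓡 n) 𝓘(ℝ, S) (P.localRep (P.indexAt x) φ) x :=
  ((contMDiffAt_totalSpace.1 (h x)).2).mdifferentiableAt (by simp)

/-! ### Global consequences of the Killing equation. -/

namespace IsGeneralizedImaginaryKilling

variable {P} {φ : Π x : N, P.Spinor Δ x}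
  {W : Π x : N, TangentSpace (𝓡 n) x →L[ℝ] TangentSpace (𝓡 n) x}

theorem mvfderiv_localRep (h : P.IsGeneralizedImaginaryKilling φ W) {x : N}
    (X : TangentSpace (𝓡 n) x) :
    mvfderiv (𝓡 n) (P.localRep (P.indexAt x) φ) x X =
      Δ.killingDeriv (P.connectionForm X) (P.coord (W x X)) (P.localRep (P.indexAt x) φ x) := by
  have h1 : mvfderiv (𝓡 n) (P.localRep (P.indexAt x) φ) x X +
      (1 / 4 : ℂ) • ∑ k, ∑ l, (P.connectionForm X k l : ℂ) •
        Δ.rep (Cl.vec (P.coord (P.frame (P.indexAt x) k x)))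
          (Δ.rep (Cl.vec (P.coord (P.frame (P.indexAt x) l x))) (P.toModel (φ x))) =
      (Complex.I / 2) • Δ.rep (Cl.vec (P.coord (W x X))) (P.toModel (φ x)) :=
    h.killing x X
  simp only [coord_frame] at h1
  rw [localRep_indexAt, SpinorModule.killingDeriv, ← h1]
  simp [SpinorModule.conn]

theorem hasMFDerivAt_comp_localRep (h : P.IsGeneralizedImaginaryKilling φ W) {x : N} {F : S → ℝ}
    {L : S →L[ℝ] ℝ} (hF : HasFDerivAt F L (P.localRep (P.indexAt x) φ x)) :
    MDifferentiableAt (𝓡 n) 𝓘(ℝ, ℝ) (fun y ↦ F (P.localRep (P.indexAt x) φ y)) x ∧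
    ∀ X, mvfderiv (𝓡 n) (fun y ↦ F (P.localRep (P.indexAt x) φ y)) x X =
      L (Δ.killingDeriv (P.connectionForm X) (P.coord (W x X))
        (P.localRep (P.indexAt x) φ x)) := by
  have h1 := hF.hasMFDerivAt.comp x
    (P.mdifferentiableAt_localRep h.smooth_spinor x).hasMFDerivAt
  refine ⟨h1.mdifferentiableAt, fun X ↦ ?_⟩
  rw [← h.mvfderiv_localRep]
  exact congrArg (fun T ↦ T X) h1.mfderiv

theorem qInvariant_eq [ConnectedSpace N] (h : P.IsGeneralizedImaginaryKilling φ W) (x y : N) :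
    P.qInvariant φ x = P.qInvariant φ y := by
  refine eq_of_forall_hasMFDerivAt_zero (n := n) (fun x ↦ ?_) x y
  obtain ⟨L, hL, hL'⟩ := Δ.hasFDerivAt_quartic (P.localRep (P.indexAt x) φ x)
  obtain ⟨h1, h2⟩ := h.hasMFDerivAt_comp_localRep hL
  have h3 : mfderiv (𝓡 n) 𝓘(ℝ, ℝ) (fun y ↦ Δ.quartic (P.localRep (P.indexAt x) φ y)) x = 0 := by
    ext X
    exact (h2 X).trans (hL' _ _ (P.connectionForm_antisymm X))
  have h4 := h1.hasMFDerivAt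
  rw [h3] at h4
  refine h4.congr_of_eventuallyEq ?_
  filter_upwards [(P.isOpen_U _).mem_nhds (P.mem_indexAt x)] with y hy
  exact P.qInvariant_eq_quartic φ hy

/-- With U ≡ 0 the norm is constant, so it suffices that φ vanishes at one point where W ≠ 0; there
∇U = 0 yields |φ|² W = 0. -/
theorem toModel_eq_zero [ConnectedSpace N] (h : P.IsGeneralizedImaginaryKilling φ W)
    (hW : ∃ x, W x ≠ 0) (hU : ∀ x, P.diracCurrent φ x = 0) (x : N) : P.toModel (φ x) = 0 := by
  have hconst : ∀ x y, P.spinorNorm (φ x) ^ 2 = P.spinorNorm (φ y) ^ 2 := by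
    refine eq_of_forall_hasMFDerivAt_zero (n := n) (fun x ↦ ?_)
    obtain ⟨L, hL, hL'⟩ := SpinorModule.hasFDerivAt_norm_sq_spinor (P.localRep (P.indexAt x) φ x)
    obtain ⟨h1, h2⟩ := h.hasMFDerivAt_comp_localRep hL
    have h3 : mfderiv (𝓡 n) 𝓘(ℝ, ℝ) (fun y ↦ ‖P.localRep (P.indexAt x) φ y‖ ^ 2) x = 0 := by
      ext X
      refine (h2 X).trans ?_
      rw [hL', Δ.re_inner_killingDeriv (P.connectionForm_antisymm X), localRep_indexAt,
        ← inner_diracCurrent_eq_current, hU]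
      simp
      rfl
    have h4 := h1.hasMFDerivAt
    rw [h3] at h4
    exact h4.congr_of_eventuallyEq
      (.of_forall fun y ↦ congrArg (· ^ 2) (P.norm_localRep φ (P.indexAt x) y).symm)
  obtain ⟨z, hz⟩ := hW
  suffices hzero : P.spinorNorm (φ z) ^ 2 = 0 by
    have := (hconst x z).trans hzero
    exact norm_eq_zero.1 (sq_eq_zero_iff.1 this)
  obtain ⟨X, hX⟩ : ∃ X, W z X ≠ 0 := by
    by_contra! hX
    exact hz (ContinuousLinearMap.ext hX)
  obtain ⟨k, hk⟩ : ∃ k, P.coord (W z X) k ≠ 0 := by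
    by_contra! hk
    apply hX
    rw [← P.sum_coord_smul (W z X)]
    simp [hk]
  obtain ⟨L, hL, hL'⟩ := Δ.hasFDerivAt_current (EuclideanSpace.single k 1)
    (P.localRep (P.indexAt z) φ z)
  have h0 : (fun y ↦ Δ.current (P.localRep (P.indexAt z) φ y) (EuclideanSpace.single k 1))
      =ᶠ[nhds z] fun _ ↦ 0 := by
    filter_upwards [(P.isOpen_U _).mem_nhds (P.mem_indexAt z)] with y hy
    rw [P.current_localRep φ hy, hU, inner_zero_left]
  -- The k-th component of U vanishes near z, so its derivative, which reduces to -|φ|² (WX)_k, is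
  -- zero.
  have h1 := (h.hasMFDerivAt_comp_localRep hL).2 X
  rw [hL', Δ.im_inner_killingDeriv (P.connectionForm_antisymm X), mvfderiv, h0.mfderiv_eq,
    mfderiv_const, localRep_indexAt] at h1
  simp only [← inner_coord_diracCurrent, hU] at h1
  have hc : P.coord (0 : TangentSpace (𝓡 n) z) = 0 := by
    simpa using P.coord_smul 0 (0 : TangentSpace (𝓡 n) z)
  have h2 : ‖P.toModel (φ z)‖ ^ 2 * P.coord (W z X) k = 0 := by
    simpa only [hc, inner_zero_left, mul_zero, Finset.sum_const_zero, add_zero, neg_mul,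
      zero_eq_neg] using show (0 : ℝ) = _ from h1
  exact (mul_eq_zero.1 h2).resolve_right hk

end IsGeneralizedImaginaryKilling

end SpinStructure

end Manifold

/-! ### The equivalence. -/

theorem mainTheorem8 {n : ℕ} {N : Type*} [TopologicalSpace N] [T2Space N]
    [SecondCountableTopology N] [ConnectedSpace N]
    [ChartedSpace (EuclideanSpace ℝ (Fin n)) N] [IsManifold (𝓡 n) ∞ N]
    [RiemannianBundle (fun x : N ↦ TangentSpace (𝓡 n) x)]
    [IsContMDiffRiemannianBundle (𝓡 n) ∞ (EuclideanSpace ℝ (Fin n))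
      (fun x : N ↦ TangentSpace (𝓡 n) x)]
    {J : Type*} (P : SpinStructure n N J)
    {S : Type*} [NormedAddCommGroup S] [InnerProductSpace ℂ S] [FiniteDimensional ℂ S]
    (Δ : SpinorModule n S)
    (φ : Π x : N, P.Spinor Δ x)
    (W : Π x : N, TangentSpace (𝓡 n) x →L[ℝ] TangentSpace (𝓡 n) x)
    (hφ : P.IsGeneralizedImaginaryKilling φ W)
    (hW : ∃ x, W x ≠ 0) :
    List.TFAE
      [P.IsTypeI φ,
        ∀ x, ‖P.diracCurrent φ x‖ = P.spinorNorm (φ x) ^ 2,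
        ∀ x, ∃ V : TangentSpace (𝓡 n) x, Complex.I • φ x = P.cliffordMul V (φ x),
        ∀ x, P.cliffordMul (P.diracCurrent φ x) (φ x)
          = (Complex.I * (‖P.diracCurrent φ x‖ : ℂ)) • φ x] := by
  have hq (x : N) : P.qInvariant φ x = 0 ↔ ‖P.diracCurrent φ x‖ = P.spinorNorm (φ x) ^ 2 := by
    rw [SpinStructure.qInvariant, sub_eq_zero, eq_comm,
      ← sq_eq_sq₀ (norm_nonneg _) (sq_nonneg (P.spinorNorm (φ x))), ← pow_mul]
  have hu (x : N) := P.inner_coord_diracCurrent φ x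
  tfae_have 1 ↔ 2 := forall_congr' hq
  tfae_have 3 → 2 := fun h x ↦ by
    obtain ⟨V, hV⟩ := h x
    rw [← P.norm_coord]
    exact SpinorModule.norm_current_eq_of_rep_eq (hu x) hV
  tfae_have 2 → 4 := fun h x ↦ by
    have h1 := SpinorModule.rep_current_self (hu x) ((P.norm_coord _).trans (h x))
    rw [P.norm_coord] at h1
    exact h1
  tfae_have 2 → 3 := fun h x ↦ by
    refine ⟨‖P.diracCurrent φ x‖⁻¹ • P.diracCurrent φ x, ?_⟩
    have h1 := SpinorModule.rep_smul_current_self (hu x) ((P.norm_coord _).trans (h x))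
    rw [P.norm_coord, ← P.coord_smul] at h1
    exact h1
  tfae_have 4 → 1 := fun h ↦ by
    -- Where U vanishes, (d) is empty; it is used only at one point z with U ≠ 0, and constancy of q
    -- carries q = 0 from z to all of N.
    by_cases hU : ∀ x, P.diracCurrent φ x = 0
    · intro x
      have h0 := hφ.toModel_eq_zero hW hU x
      rw [hq, hU, SpinStructure.spinorNorm, h0]
      simp
    · push Not at hU
      obtain ⟨z, hz⟩ := hU
      intro x
      rw [hφ.qInvariant_eq x z, hq, ← P.norm_coord]
      have hz' : P.coord (P.diracCurrent φ z) ≠ 0 := by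
        rwa [← norm_ne_zero_iff, P.norm_coord, norm_ne_zero_iff]
      refine SpinorModule.norm_current_eq_of_rep_self (hu z) hz' ?_
      rw [P.norm_coord]
      exact h z
  tfae_finish
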